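/- **Conventions.** A d-space $(X,PX)$ is a topological space $X$ with a set $PX$ of continuous maps $I=[0,1]\to X$ (d-paths), with the compact-open topology, containing the constant maps and closed under concatenation and under precomposition with continuous nondecreasing maps $I\to I$. Put $\Gamma_X=\{(x,y): \exists p\in PX,\ p(0)=x,\ p(1)=y\}$, $\chi:PX\to\Gamma_X$, $\chi(p)=(p(0),p(1))$, and let $PX(a,b)\subset PX$ be the subspace of d-paths from $a$ to $b$. It is a pospace if, for some partial order on $X$ with closed graph, $PX$ consists of all continuous nondecreasing maps $I\to X$. A d-map is a continuous map $f$ with $f\circ p$ a d-path for every d-path $p$; $Pf$ denotes $p\mapsto f\circ p$. *Directed topological complexity.* $\overrightarrow{TC}(X)$ is the least $n$ (or $\infty$) such that $\chi$ has a (not necessarily continuous) section $s$ and $\Gamma_X$ is a disjoint union of $n$ Euclidean neighbourhood retracts (ENRs) on each of which $s$ is continuous. *Dicontractibility.* A graded map $F:PY\multimap PX$ along $q:X\to Y$ is a family of continuous maps $PY(v,v')\times W_{v,v'}\to PX$ $(v,v'\in Y)$, where $W_{v,v'}=\{(x,x')\in\Gamma_X: q(x)=v,\ q(x')=v'\}$,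 sending $(p,x,x')$ to $F_{x,x'}(p)\in PX(x,x')$. A simple dihomotopy equivalence $X\to Y$ is a d-map $f$ for which there are a d-map $g:Y\to X$ that is a homotopy inverse of $f$, and graded maps $F:PY\multimap PX$ along $f$ and $G:PX\multimap PY$ along $g$, such that $Pf:PX(x,x')\to PY(f(x),f(x'))$ and $F_{x,x'}$ are mutually inverse homotopy equivalences for all $(x,x')\in\Gamma_X$, and likewise $Pg:PY(y,y')\to PX(g(y),g(y'))$ and $G_{y,y'}$ for all $(y,y')\in\Gamma_Y$. $X$ is dicontractible if there is a simple dihomotopy equivalence from $X$ to a point. *Natural homology.* The trace $\langle p\rangle$ of a d-path is its class for the equivalence relation generated by $p\sim p\circ\gamma$, $\gamma:I\to I$ a nondecreasing continuous surjection; the trace space $\overrightarrow{T}(X)(a,b)$ is the corresponding quotient of $PX(a,b)$, with the quotient topology. The category $\mathcal T_X$ has the traces as objects; a morphism $\langle p\rangle\to\langle q\rangle$ is a pair of traces $(\langle\alpha\rangle,\langle\beta\rangle)$ with $\langle q\rangle=\langle\alpha\star p\star\beta\rangle$. For $n\ge1$ the natural homology $\overrightarrow{H}_n(X):\mathcal T_X\to\mathbf{Ab}$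 sends $\langle p\rangle$, $p$ a d-path from $x$ to $y$, to the singular homology group $H_{n-1}(\overrightarrow{T}(X)(x,y);\mathbb Z)$, and $(\langle\alpha\rangle,\langle\beta\rangle)$ to the homomorphism induced by $\langle r\rangle\mapsto\langle\alpha\star r\star\beta\rangle$. *Bisimulation.* Functors $P:\mathcal F\to\mathbf{Ab}$, $Q:\mathcal G\to\mathbf{Ab}$ are bisimulation equivalent if there is a set $R$ of triples $(x,\eta,y)$, $x\in\mathcal F$, $y\in\mathcal G$, $\eta:P(x)\cong Q(y)$, in which every $x$ and every $y$ occurs, such that for $(x,\eta,y)\in R$: for every $f:x\to x'$ in $\mathcal F$ there are $g:y\to y'$ and $(x',\eta',y')\in R$ with $\eta'\circ P(f)=Q(g)\circ\eta$; and for every $g:y\to y'$ in $\mathcal G$ there are $f:x\to x'$ and $(x',\eta',y')\in R$ with the same equality. **Proposition.** Let $(X,PX)$ be a d-space whose underlying space $X$ is an ENR. Suppose that either $X$ is a pospace with $\overrightarrow{TC}(X)=1$, or $X$ is dicontractible (and then an arbitrary d-space). Then $\overrightarrow{H}_1(X)$ is bisimulation equivalent to the functor $1_{\mathbb Z}:\mathbf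 1\to\mathbf{Ab}$ with value $\mathbb Z$ on the terminal category $\mathbf 1$, and for every $n>1$, $\overrightarrow{H}_n(X)$ is bisimulation equivalent to the functor $1_0:\mathbf 1\to\mathbf{Ab}$ with value $0$. -/

import Mathlib

open CategoryTheory unitInterval

universe u v w

noncomputable section

/-! ### Euclidean neighbourhood retracts -/

/-- A Euclidean neighbourhood retract: `X` embeds in some `ℝⁿ` as a retract of an open
neighbourhood of its image. -/
def IsENR (X : Type*) [TopologicalSpace X] : Prop :=
  ∃ (n : ℕ) (e : X → EuclideanSpace ℝ (Fin n)) (U : Set (EuclideanSpace ℝ (Fin n)))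
    (hU : ∀ x, e x ∈ U) (r : U → X),
    Topology.IsEmbedding e ∧ IsOpen U ∧ Continuous r ∧ ∀ x, r ⟨e x, hU x⟩ = x

/-! ### d-spaces -/

/-- A d-structure on the topological space `X`: a set of paths containing the constant paths and
closed under precomposition with continuous nondecreasing maps `I → I` and under concatenation. -/
structure DSpace (X : Type u) [TopologicalSpace X] where
  /-- the set `PX` of directed paths -/
  paths : Set C(I, X)
  const_mem : ∀ x : X, ContinuousMap.const I x ∈ paths
  comp_mem : ∀ p ∈ paths, ∀ φ : C(I, I), Monotone φ → p.comp φ ∈ paths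
  trans_mem : ∀ {x y z : X} (p : Path x y) (q : Path y z),
    (p : C(I, X)) ∈ paths → (q : C(I, X)) ∈ paths → (p.trans q : C(I, X)) ∈ paths

namespace DSpace

variable {X : Type u} [TopologicalSpace X] {Y : Type v} [TopologicalSpace Y]

/-- The space `PX` of all directed paths, with the compact-open topology. -/
abbrev PathSpace (D : DSpace X) : Type u := {p : C(I, X) // p ∈ D.paths}

/-- `Γ_X`: the pairs `(x, y)` such that there is a directed path from `x` to `y`. -/
def Γ (D : DSpace X) : Set (X × X) :=
  {z | ∃ p : D.PathSpace, p.1 0 = z.1 ∧ p.1 1 = z.2}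

/-- The d-paths map `χ : PX → Γ_X`, `χ p = (p 0, p 1)`. -/
def χ (D : DSpace X) (p : D.PathSpace) : D.Γ := ⟨(p.1 0, p.1 1), p, rfl, rfl⟩

/-- The space `PX(a, b)` of directed paths from `a` to `b`. (The topology of `Path a b` is the
compact-open one.) -/
abbrev DPath (D : DSpace X) (a b : X) : Type u := {p : Path a b // (p : C(I, X)) ∈ D.paths}

/-- `Γ_X` can be partitioned into `n` ENRs on each of which a (not necessarily continuous)
section `s` of `χ` is continuous. -/
def HasPatchwork (D : DSpace X) (n : ℕ) : Prop :=
  ∃ (s : D.Γ → D.PathSpace) (F : Fin n → Set D.Γ),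
    (∀ z, D.χ (s z) = z) ∧ (⋃ i, F i) = Set.univ ∧ Pairwise (fun i j => Disjoint (F i) (F j)) ∧
    ∀ i, IsENR (F i) ∧ ContinuousOn s (F i)

/-- The directed topological complexity: the least `n` as above, or `∞`. -/
def diTC (D : DSpace X) : ℕ∞ := ⨅ (n : ℕ) (_ : D.HasPatchwork n), (n : ℕ∞)

/-- The d-space is (that of) a pospace: for some partial order with closed graph, the directed paths
are exactly the continuous nondecreasing maps `I → X`. -/
def IsPospace (D : DSpace X) : Prop :=
  ∃ _ : PartialOrder X, IsClosed {z : X × X | z.1 ≤ z.2} ∧ D.paths = {p : C(I, X) | Monotone p}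

/-- The one-point d-space. -/
def point : DSpace Unit where
  paths := Set.univ
  const_mem _ := trivial
  comp_mem _ _ _ _ := trivial
  trans_mem _ _ _ _ := trivial

/-! ### Simple dihomotopy equivalences -/

/-- d-maps. -/
def IsDMap (D : DSpace X) (E : DSpace Y) (f : C(X, Y)) : Prop :=
  ∀ p ∈ D.paths, f.comp p ∈ E.paths

/-- The map `Pf : PX(a, b) → PY(f a, f b)` induced by a d-map `f`. -/
def mapDPath {D : DSpace X} {E : DSpace Y} (f : C(X, Y)) (hf : IsDMap D E f) (a b : X) :
    C(D.DPath a b, E.DPath (f a) (f b)) where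
  toFun p := ⟨p.1.map f.continuous, hf _ p.2⟩
  continuous_toFun := by
    refine Continuous.subtype_mk ?_ _
    refine continuous_induced_rng.2 ?_
    exact (ContinuousMap.continuous_postcomp f).comp
      (continuous_induced_dom.comp continuous_subtype_val)

/-- A map `PY ⊸ PX` continuously graded along `q : X → Y`: for all `v, v'` in `Y` a continuous map
`h : PY(v, v') × W → PX` with `h(p, x, x') ∈ PX(x, x')`, where `W` is the set of `(x, x') ∈ Γ_X`
lying over `(v, v')`. -/
structure GradedMap (D : DSpace X) (E : DSpace Y) (q : C(X, Y)) where
  toFun : ∀ v v' : Y,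
    C(E.DPath v v' × {w : X × X // w ∈ D.Γ ∧ q w.1 = v ∧ q w.2 = v'}, D.PathSpace)
  source : ∀ v v' p w, (toFun v v' (p, w)).1 0 = w.1.1
  target : ∀ v v' p w, (toFun v v' (p, w)).1 1 = w.1.2

/-- The component `F_{x,x'} : PY(q x, q x') → PX(x, x')` of a graded map. -/
def GradedMap.component {D : DSpace X} {E : DSpace Y} {q : C(X, Y)} (F : GradedMap D E q)
    (x x' : X) (h : (x, x') ∈ D.Γ) : C(E.DPath (q x) (q x'), D.DPath x x') where
  toFun p := ⟨⟨(F.toFun _ _ (p, ⟨(x, x'), h, rfl, rfl⟩)).1, F.source _ _ _ _, F.target _ _ _ _⟩,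
    (F.toFun _ _ (p, ⟨(x, x'), h, rfl, rfl⟩)).2⟩
  continuous_toFun := by
    refine Continuous.subtype_mk ?_ _
    refine continuous_induced_rng.2 ?_
    exact continuous_subtype_val.comp ((F.toFun _ _).continuous.comp (by fun_prop))

/-- Two continuous maps in opposite directions are mutually inverse homotopy equivalences. -/
def AreHomotopyInverse {A : Type*} {B : Type*} [TopologicalSpace A] [TopologicalSpace B]
    (f : C(A, B)) (g : C(B, A)) : Prop :=
  (g.comp f).Homotopic (ContinuousMap.id A) ∧ (f.comp g).Homotopic (ContinuousMap.id B)

/-- `f : X → Y` is a simple dihomotopy equivalence. -/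
def IsSimpleDihomotopyEquiv (D : DSpace X) (E : DSpace Y) (f : C(X, Y)) : Prop :=
  ∃ (hf : IsDMap D E f) (g : C(Y, X)) (hg : IsDMap E D g),
    AreHomotopyInverse f g ∧
    (∃ F : GradedMap D E f, ∀ (x x' : X) (h : (x, x') ∈ D.Γ),
      AreHomotopyInverse (mapDPath f hf x x') (F.component x x' h)) ∧
    (∃ G : GradedMap E D g, ∀ (y y' : Y) (h : (y, y') ∈ E.Γ),
      AreHomotopyInverse (mapDPath g hg y y') (G.component y y' h))

/-- `X` is dicontractible: it is simply dihomotopy equivalent to a point. -/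
def IsDicontractible (D : DSpace X) : Prop :=
  ∃ f : C(X, Unit), IsSimpleDihomotopyEquiv D point f

/-! ### Traces -/

/-- `p` is reparametrized in `q`: `p ∘ γ = q` for a monotone continuous surjection `γ : I → I`. -/
def Reparam {D : DSpace X} {a b : X} (p q : D.DPath a b) : Prop :=
  ∃ γ : C(I, I), Monotone γ ∧ Function.Surjective γ ∧ ∀ t, p.1 (γ t) = q.1 t

/-- The trace space from `a` to `b`: the quotient of `PX(a, b)` by the equivalence relation
generated by reparametrization, with the quotient topology. -/
def Trace (D : DSpace X) (a b : X) : Type u := Quot (Reparam (D := D) (a := a) (b := b))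

instance (D : DSpace X) (a b : X) : TopologicalSpace (D.Trace a b) :=
  inferInstanceAs (TopologicalSpace (Quot _))

/-- The trace `⟨p⟩` of a directed path. -/
def Trace.mk {D : DSpace X} {a b : X} (p : D.DPath a b) : D.Trace a b := Quot.mk _ p

/-- The constant directed path. -/
def DPath.refl (D : DSpace X) (a : X) : D.DPath a a := ⟨Path.refl a, D.const_mem a⟩

/-- Concatenation of directed paths. -/
def DPath.trans {D : DSpace X} {a b c : X} (p : D.DPath a b) (q : D.DPath b c) : D.DPath a c :=
  ⟨p.1.trans q.1, D.trans_mem _ _ p.2 q.2⟩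

theorem surjective_of_endpoints (γ : C(I, I)) (h0 : γ 0 = 0) (h1 : γ 1 = 1) :
    Function.Surjective γ := by
  intro y
  have := intermediate_value_univ (0 : I) 1 γ.continuous
  exact this ⟨by rw [h0]; exact y.2.1, by rw [h1]; exact y.2.2⟩

theorem endpoints_of_surjective (γ : C(I, I)) (hm : Monotone γ) (hs : Function.Surjective γ) :
    γ 0 = 0 ∧ γ 1 = 1 := by
  obtain ⟨s, h0⟩ := hs 0
  obtain ⟨t, h1⟩ := hs 1
  have h0' : γ 0 ≤ γ s := hm unitInterval.nonneg'
  have h1' : γ t ≤ γ 1 := hm unitInterval.le_one'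
  rw [h0] at h0'
  rw [h1] at h1'
  exact ⟨le_antisymm h0' unitInterval.nonneg', le_antisymm unitInterval.le_one' h1'⟩

theorem Reparam.trans_left {D : DSpace X} {a b c : X} {p p' : D.DPath a b} (h : Reparam p p')
    (q : D.DPath b c) : Reparam (p.trans q) (p'.trans q) := by
  obtain ⟨γ, hm, hs, hγ⟩ := h
  obtain ⟨h0, h1⟩ := endpoints_of_surjective γ hm hs
  let g : ℝ → ℝ := fun t =>
    if t ≤ 1 / 2 then (γ (Set.projIcc 0 1 zero_le_one (2 * t)) : ℝ) / 2 else t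
  have hg : Continuous g := by
    refine Continuous.if_le (by fun_prop) continuous_id continuous_id continuous_const ?_
    intro x hx
    have : Set.projIcc (0 : ℝ) 1 zero_le_one (2 * x) = 1 := by
      rw [hx]; norm_num
    rw [this, h1, hx]; norm_num
  have hI : ∀ t : I, g t ∈ I := by
    intro t
    have h2 := (γ (Set.projIcc 0 1 zero_le_one (2 * (t : ℝ)))).2
    have h3 := t.2
    simp only [g]
    split_ifs
    · exact ⟨by linarith [h2.1], by linarith [h2.2]⟩
    · exact h3
  refine ⟨⟨fun t => ⟨g t, hI t⟩, by fun_prop⟩, ?_, ?_, ?_⟩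
  · intro s t hst
    have hst' : (s : ℝ) ≤ t := hst
    change g s ≤ g t
    simp only [g]
    have h2 := (γ (Set.projIcc 0 1 zero_le_one (2 * (s : ℝ)))).2
    split_ifs with h3 h4 h4
    · have : γ (Set.projIcc 0 1 zero_le_one (2 * (s : ℝ))) ≤
          γ (Set.projIcc 0 1 zero_le_one (2 * (t : ℝ))) :=
        hm (Set.monotone_projIcc _ (by linarith))
      have : (γ (Set.projIcc 0 1 zero_le_one (2 * (s : ℝ))) : ℝ) ≤
          γ (Set.projIcc 0 1 zero_le_one (2 * (t : ℝ))) := this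
      linarith
    · linarith [h2.2]
    · linarith
    · exact hst'
  · apply surjective_of_endpoints
    · ext
      change g ((0 : I) : ℝ) = 0
      simp [g, h0]
    · ext
      change g ((1 : I) : ℝ) = 1
      norm_num [g]
  · intro t
    have h2 := (γ (Set.projIcc 0 1 zero_le_one (2 * (t : ℝ)))).2
    change (p.1.trans q.1) ⟨g t, hI t⟩ = (p'.1.trans q.1) t
    rw [Path.trans_apply, Path.trans_apply]
    by_cases ht : (t : ℝ) ≤ 1 / 2
    · have hgt : g t = (γ (Set.projIcc 0 1 zero_le_one (2 * (t : ℝ))) : ℝ) / 2 := by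
        simp only [g, if_pos ht]
      have hle : g t ≤ 1 / 2 := by rw [hgt]; linarith [h2.2]
      rw [dif_pos hle, dif_pos ht, ← hγ]
      congr 1
      ext
      change 2 * g t = _
      rw [hgt, Set.projIcc_of_mem zero_le_one
        (⟨by linarith [t.2.1], by linarith⟩ : 2 * (t : ℝ) ∈ Set.Icc (0 : ℝ) 1)]
      ring
    · have hgt : g t = t := by simp only [g, if_neg ht]
      have hle : ¬ g t ≤ 1 / 2 := by rw [hgt]; exact ht
      rw [dif_neg hle, dif_neg ht]
      congr 1
      ext
      change 2 * g t - 1 = 2 * t - 1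
      rw [hgt]

theorem Reparam.trans_right {D : DSpace X} {a b c : X} (p : D.DPath a b) {q q' : D.DPath b c}
    (h : Reparam q q') : Reparam (p.trans q) (p.trans q') := by
  obtain ⟨γ, hm, hs, hγ⟩ := h
  obtain ⟨h0, h1⟩ := endpoints_of_surjective γ hm hs
  let g : ℝ → ℝ := fun t =>
    if t ≤ 1 / 2 then t else (1 + (γ (Set.projIcc 0 1 zero_le_one (2 * t - 1)) : ℝ)) / 2
  have hg : Continuous g := by
    refine Continuous.if_le continuous_id (by fun_prop) continuous_id continuous_const ?_
    intro x hx
    have : Set.projIcc (0 : ℝ) 1 zero_le_one (2 * x - 1) = 0 := by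
      rw [hx]; norm_num
    rw [this, h0, hx]; norm_num
  have hI : ∀ t : I, g t ∈ I := by
    intro t
    have h2 := (γ (Set.projIcc 0 1 zero_le_one (2 * (t : ℝ) - 1))).2
    have h3 := t.2
    simp only [g]
    split_ifs
    · exact h3
    · exact ⟨by linarith [h2.1], by linarith [h2.2]⟩
  refine ⟨⟨fun t => ⟨g t, hI t⟩, by fun_prop⟩, ?_, ?_, ?_⟩
  · intro s t hst
    have hst' : (s : ℝ) ≤ t := hst
    change g s ≤ g t
    simp only [g]
    have h2 := (γ (Set.projIcc 0 1 zero_le_one (2 * (t : ℝ) - 1))).2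
    split_ifs with h3 h4 h4
    · exact hst'
    · linarith [h2.1]
    · linarith
    · have : γ (Set.projIcc 0 1 zero_le_one (2 * (s : ℝ) - 1)) ≤
          γ (Set.projIcc 0 1 zero_le_one (2 * (t : ℝ) - 1)) :=
        hm (Set.monotone_projIcc _ (by linarith))
      have : (γ (Set.projIcc 0 1 zero_le_one (2 * (s : ℝ) - 1)) : ℝ) ≤
          γ (Set.projIcc 0 1 zero_le_one (2 * (t : ℝ) - 1)) := this
      linarith
  · apply surjective_of_endpoints
    · ext
      change g ((0 : I) : ℝ) = 0
      simp [g]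
    · ext
      change g ((1 : I) : ℝ) = 1
      have : Set.projIcc (0 : ℝ) 1 zero_le_one (2 * ((1 : I) : ℝ) - 1) = 1 := by norm_num
      simp only [g, this, h1]
      norm_num
  · intro t
    have h2 := (γ (Set.projIcc 0 1 zero_le_one (2 * (t : ℝ) - 1))).2
    change (p.1.trans q.1) ⟨g t, hI t⟩ = (p.1.trans q'.1) t
    by_cases ht : (t : ℝ) ≤ 1 / 2
    · have hgt : g t = t := by simp only [g, if_pos ht]
      rw [Path.trans_apply, Path.trans_apply]
      have hle : g t ≤ 1 / 2 := by rw [hgt]; exact ht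
      rw [dif_pos hle, dif_pos ht]
      congr 1
      ext
      change 2 * g t = 2 * t
      rw [hgt]
    · have hgt : g t = (1 + (γ (Set.projIcc 0 1 zero_le_one (2 * (t : ℝ) - 1)) : ℝ)) / 2 := by
        simp only [g, if_neg ht]
      have hge : 1 / 2 ≤ g t := by rw [hgt]; linarith [h2.1]
      rw [← Path.extend_apply (p.1.trans q.1) (hI t), Path.extend_trans_of_half_le _ _ hge,
        Path.trans_apply, dif_neg ht, ← hγ, hgt,
        Path.extend_apply q.1 (t := 2 * ((1 +
          (γ (Set.projIcc 0 1 zero_le_one (2 * (t : ℝ) - 1)) : ℝ)) / 2) - 1)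
          ⟨by linarith [h2.1], by linarith [h2.2]⟩]
      have hpr := Set.projIcc_of_mem zero_le_one
        (⟨by linarith [not_le.1 ht], by linarith [t.2.2]⟩ : 2 * (t : ℝ) - 1 ∈ Set.Icc (0 : ℝ) 1)
      rw [← hpr]
      congr 1
      ext
      change 2 * ((1 + _) / 2) - 1 = _
      ring

/-- Concatenation of traces. -/
def Trace.trans {D : DSpace X} {a b c : X} (p : D.Trace a b) (q : D.Trace b c) : D.Trace a c :=
  Quot.map₂ DPath.trans (fun p _ _ h => Reparam.trans_right p h)
    (fun _ _ q h => Reparam.trans_left h q) p q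

/-- The trace of a constant path. -/
def Trace.refl (D : DSpace X) (a : X) : D.Trace a a := Trace.mk (DPath.refl D a)

theorem Trace.trans_refl {D : DSpace X} {a b : X} (p : D.Trace a b) :
    p.trans (Trace.refl D b) = p := by
  induction p using Quot.ind with | mk p =>
  refine (Quot.sound ⟨⟨fun t => ⟨Path.Homotopy.transReflReparamAux t,
    Path.Homotopy.transReflReparamAux_mem_I t⟩, by fun_prop⟩, ?_, ?_, fun t => ?_⟩).symm
  · intro s t hst
    have hst' : (s : ℝ) ≤ t := hst
    change Path.Homotopy.transReflReparamAux s ≤ Path.Homotopy.transReflReparamAux t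
    unfold Path.Homotopy.transReflReparamAux
    split_ifs <;> linarith
  · exact surjective_of_endpoints _ (Subtype.ext Path.Homotopy.transReflReparamAux_zero)
      (Subtype.ext Path.Homotopy.transReflReparamAux_one)
  · exact (congrArg (fun r : Path a b => r t) (Path.Homotopy.trans_refl_reparam p.1)).symm

theorem Trace.refl_trans {D : DSpace X} {a b : X} (p : D.Trace a b) :
    (Trace.refl D a).trans p = p := by
  induction p using Quot.ind with | mk p =>
  refine (Quot.sound ⟨⟨fun t => Set.projIcc 0 1 zero_le_one (2 * (t : ℝ) - 1), by fun_prop⟩,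
    ?_, ?_, fun t => ?_⟩).symm
  · intro s t hst
    have hst' : (s : ℝ) ≤ t := hst
    exact Set.monotone_projIcc zero_le_one (by linarith)
  · apply surjective_of_endpoints
    · exact Set.projIcc_of_le_left zero_le_one (by norm_num)
    · exact Set.projIcc_of_right_le zero_le_one (by norm_num)
  · change p.1 (Set.projIcc 0 1 zero_le_one (2 * (t : ℝ) - 1)) = ((Path.refl a).trans p.1) t
    rw [Path.trans_apply]
    split_ifs with ht
    · rw [Set.projIcc_of_le_left _ (by linarith)]
      exact p.1.source
    · rw [Set.projIcc_of_mem zero_le_one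
        (⟨by linarith [not_le.1 ht], by linarith [t.2.2]⟩ : 2 * (t : ℝ) - 1 ∈ Set.Icc (0 : ℝ) 1)]

theorem Trace.trans_assoc {D : DSpace X} {a b c d : X} (p : D.Trace a b) (q : D.Trace b c)
    (r : D.Trace c d) : (p.trans q).trans r = p.trans (q.trans r) := by
  induction p using Quot.ind with | mk p =>
  induction q using Quot.ind with | mk q =>
  induction r using Quot.ind with | mk r =>
  refine (Quot.sound ⟨⟨fun t => ⟨Path.Homotopy.transAssocReparamAux t,
    Path.Homotopy.transAssocReparamAux_mem_I t⟩, by fun_prop⟩, ?_, ?_, fun t => ?_⟩).symm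
  · intro s t hst
    have hst' : (s : ℝ) ≤ t := hst
    change Path.Homotopy.transAssocReparamAux s ≤ Path.Homotopy.transAssocReparamAux t
    unfold Path.Homotopy.transAssocReparamAux
    split_ifs <;> linarith
  · exact surjective_of_endpoints _ (Subtype.ext Path.Homotopy.transAssocReparamAux_zero)
      (Subtype.ext Path.Homotopy.transAssocReparamAux_one)
  · exact (congrArg (fun s : Path a d => s t)
      (Path.Homotopy.trans_assoc_reparam p.1 q.1 r.1)).symm

/-- The extension map `⟨α ⋆ _ ⋆ β⟩` on trace spaces. -/
def Trace.extend {D : DSpace X} {x y x' y' : X} (α : D.Trace x' x) (β : D.Trace y y') :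
    C(D.Trace x y, D.Trace x' y') where
  toFun p := (α.trans p).trans β
  continuous_toFun := by
    induction α using Quot.ind with | mk α =>
    induction β using Quot.ind with | mk β =>
    refine continuous_coinduced_dom.2 ?_
    have : Continuous fun p : D.DPath x y => (α.trans p).trans β := by
      unfold DPath.trans
      refine Continuous.subtype_mk ?_ _
      fun_prop
    exact continuous_quot_mk.comp this

/-! ### The trace category and natural homology -/

/-- The objects of the trace category `T_X`: the traces of `X`. -/
structure TraceCat (D : DSpace X) : Type u where
  src : X
  tgt : X
  trace : D.Trace src tgt

/-- The morphisms (extensions) of `T_X` from `⟨p⟩` to `⟨q⟩`: the pairs of traces `(⟨α⟩, ⟨β⟩)` with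
`⟨q⟩ = ⟨α ⋆ p ⋆ β⟩`. -/
@[ext]
structure TraceCat.Hom {D : DSpace X} (p q : D.TraceCat) : Type u where
  left : D.Trace q.src p.src
  right : D.Trace p.tgt q.tgt
  eq : q.trace = (left.trans p.trace).trans right

instance (D : DSpace X) : Category.{u} D.TraceCat where
  Hom := TraceCat.Hom
  id p := ⟨Trace.refl D _, Trace.refl D _, by rw [Trace.refl_trans, Trace.trans_refl]⟩
  comp f g := ⟨g.left.trans f.left, f.right.trans g.right, by
    rw [g.eq, f.eq]; simp only [Trace.trans_assoc]⟩
  id_comp f := TraceCat.Hom.ext (Trace.trans_refl _) (Trace.refl_trans _)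
  comp_id f := TraceCat.Hom.ext (Trace.refl_trans _) (Trace.trans_refl _)
  assoc f g h := TraceCat.Hom.ext (Trace.trans_assoc _ _ _).symm (Trace.trans_assoc _ _ _)

/-- The functor from `T_X` to pointed spaces (spaces under the one-point space), sending the trace
`⟨p⟩` of a directed path from `x` to `y` to the trace space from `x` to `y` pointed at `⟨p⟩`. -/
def pointedTrace (D : DSpace X) : D.TraceCat ⥤ Under (TopCat.of PUnit.{u + 1}) where
  obj p := Under.mk (Y := TopCat.of (D.Trace p.src p.tgt))
    (TopCat.ofHom (ContinuousMap.const PUnit p.trace))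
  map {p q} f := Under.homMk (TopCat.ofHom (Trace.extend f.left f.right)) (by
    ext
    exact f.eq.symm)
  map_id p := by
    ext t
    change ((Trace.refl D _).trans t).trans (Trace.refl D _) = t
    rw [Trace.refl_trans, Trace.trans_refl]
  map_comp f g := by
    ext t
    change ((g.left.trans f.left).trans t).trans (f.right.trans g.right) =
      (g.left.trans ((f.left.trans t).trans f.right)).trans g.right
    simp only [Trace.trans_assoc]

/-- The `n`-th natural homology functor, `n ≥ 1`: the `(n - 1)`-st singular homology group, with
integer coefficients, of the trace spaces. (Only the values at `n ≥ 1` are meaningful.) -/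
def naturalHomology (D : DSpace X) (n : ℕ) : D.TraceCat ⥤ AddCommGrpCat.{u} :=
  D.pointedTrace ⋙ Under.forget _ ⋙
    (AlgebraicTopology.singularHomologyFunctor AddCommGrpCat.{u} (n - 1)).obj
      (AddCommGrpCat.of (ULift.{u} ℤ))

end DSpace

/-! ### Bisimulations -/

/-- A bisimulation between `P : F ⥤ Ab` and `Q : G ⥤ Ab`: a set of triples `(x, η, y)`, with
`η : P x ≅ Q y`, relating every object on either side to some object on the other, and hereditary
along the morphisms of `F` and of `G`. -/
structure IsBisimulation {F : Type*} {G : Type*} [Category* F] [Category* G]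
    (P : F ⥤ AddCommGrpCat.{w}) (Q : G ⥤ AddCommGrpCat.{w})
    (R : ∀ (x : F) (y : G), Set (P.obj x ≅ Q.obj y)) : Prop where
  total_left : ∀ x, ∃ y, (R x y).Nonempty
  total_right : ∀ y, ∃ x, (R x y).Nonempty
  forth : ∀ {x x' : F} (f : x ⟶ x') {y : G}, ∀ η ∈ R x y,
    ∃ (y' : G) (g : y ⟶ y'), ∃ η' ∈ R x' y', P.map f ≫ η'.hom = η.hom ≫ Q.map g
  back : ∀ {y y' : G} (g : y ⟶ y') {x : F}, ∀ η ∈ R x y,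
    ∃ (x' : F) (f : x ⟶ x'), ∃ η' ∈ R x' y', P.map f ≫ η'.hom = η.hom ≫ Q.map g

/-- Bisimulation equivalence of functors into abelian groups. -/
def BisimulationEquivalent {F : Type*} {G : Type*} [Category* F] [Category* G]
    (P : F ⥤ AddCommGrpCat.{w}) (Q : G ⥤ AddCommGrpCat.{w}) : Prop :=
  ∃ R : ∀ (x : F) (y : G), Set (P.obj x ≅ Q.obj y), IsBisimulation P Q R

/-- The functor from the terminal category (one object, one morphism) with value `A`. -/
def oneFunctor (A : AddCommGrpCat.{w}) : Discrete PUnit.{1} ⥤ AddCommGrpCat.{w} :=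
  Functor.fromPUnit A

end

/-! Everything reduces to the contractibility of the trace spaces from `a` to `b` with `(a, b)` in
`Γ`. Extension maps then induce isomorphisms in homology, the groups are `ℤ` in degree 0 and zero
above, and the relation made of all isomorphisms is a bisimulation
(`bisimulationEquivalent_oneFunctor`).

Both hypotheses provide a continuous section `s` of `χ` whose loops `s (a, a)` can be joined to
constant loops inside `PX(a, a)`. For a directed path `p`, replace the part before time `t` by `s
(a, p t)`. As `t` runs from 0 to 1, this deforms `s (a, a) ⋆ p` into `s (a, b)` followed by a
constant path, which does not depend on `p`; and `s (a, a) ⋆ p` deforms to `p` through loops at `a`.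

The obstacle is that time is not an invariant of the trace: reparametrizing `p` changes the
replacement made at time `t`. Time is therefore measured by a Morse length, which is continuous in
the path, invariant under reparametrization, and stops only where the path stops
(`eq_of_morseClock_eq`). Since the replacement does not change while the path rests, it is a
continuous function of the normalized clock (`exists_continuousMap_of_clock`), and the deformation
descends to traces (`Trace.homotopic_const`). -/

/-! ### Morse length of a path -/

section MorseLength

variable {M : Type*} [MetricSpace M]

/-- The supremum, over the chains of `n + 2` points on the path `q`, of the least distance between
two consecutive points. -/
noncomputable def chainGap (n : ℕ) (q : C(I, M)) : ℝ :=
  ⨆ t : ℕ →o I, ⨅ i : Fin (n + 1), dist (q (t i)) (q (t (i + 1)))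

theorem chainGap_bddBelow (n : ℕ) (q : C(I, M)) (t : ℕ →o I) :
    BddBelow (Set.range fun i : Fin (n + 1) => dist (q (t i)) (q (t (i + 1)))) :=
  ⟨0, by rintro _ ⟨i, rfl⟩; exact dist_nonneg⟩

theorem chainGap_bddAbove (n : ℕ) (q : C(I, M)) :
    BddAbove (Set.range fun t : ℕ →o I =>
      ⨅ i : Fin (n + 1), dist (q (t i)) (q (t (i + 1)))) := by
  obtain ⟨C, hC⟩ := Metric.isBounded_iff.1 (isCompact_range q.continuous).isBounded
  refine ⟨C, ?_⟩
  rintro _ ⟨t, rfl⟩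
  exact (ciInf_le (chainGap_bddBelow n q t) 0).trans (hC ⟨_, rfl⟩ ⟨_, rfl⟩)

theorem lt_chainGap_iff {n : ℕ} {q : C(I, M)} {e : ℝ} :
    e < chainGap n q ↔ ∃ t : ℕ →o I, ∀ i < n + 1, e < dist (q (t i)) (q (t (i + 1))) := by
  constructor
  · intro h
    obtain ⟨t, ht⟩ := exists_lt_of_lt_ciSup h
    exact ⟨t, fun i hi => ht.trans_le (ciInf_le (chainGap_bddBelow n q t) ⟨i, hi⟩)⟩
  · rintro ⟨t, ht⟩
    refine lt_of_lt_of_le ?_ (le_ciSup (chainGap_bddAbove n q) t)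
    obtain ⟨i, hi⟩ := exists_eq_ciInf_of_finite
      (f := fun i : Fin (n + 1) => dist (q (t i)) (q (t (i + 1))))
    rw [← hi]
    exact ht i i.2

theorem chainGap_nonneg (n : ℕ) (q : C(I, M)) : 0 ≤ chainGap n q :=
  Real.iSup_nonneg fun _ => Real.iInf_nonneg fun _ => dist_nonneg

theorem chainGap_comp_le (n : ℕ) (q : C(I, M)) (γ : C(I, I)) (hγ : Monotone γ) :
    chainGap n (q.comp γ) ≤ chainGap n q :=
  ciSup_le fun t => le_ciSup (chainGap_bddAbove n q) (OrderHom.comp ⟨γ, hγ⟩ t)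

/-- Any right inverse of a monotone surjection is monotone, so chains on `q` lift along `γ`. -/
theorem chainGap_comp (n : ℕ) (q : C(I, M)) (γ : C(I, I)) (hγ : Monotone γ)
    (hs : Function.Surjective γ) : chainGap n (q.comp γ) = chainGap n q := by
  refine le_antisymm (chainGap_comp_le n q γ hγ) (ciSup_le fun t => ?_)
  have hm : Monotone (Function.surjInv hs) := by
    intro a b hab
    by_contra! h
    have := hγ h.le
    rw [Function.surjInv_eq hs, Function.surjInv_eq hs] at this
    exact h.ne (by rw [le_antisymm this hab])
  refine Eq.trans_le ?_ (le_ciSup (chainGap_bddAbove n (q.comp γ)) (OrderHom.comp ⟨_, hm⟩ t))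
  simp [Function.surjInv_eq hs]

/-- Each step of a chain has two endpoints, so its length changes by at most twice the uniform
distance between the paths. -/
theorem continuous_chainGap (n : ℕ) : Continuous (chainGap n : C(I, M) → ℝ) := by
  refine (LipschitzWith.of_le_add_mul 2 fun p q => ?_).continuous
  refine ciSup_le fun t => ?_
  rw [← sub_le_iff_le_add]
  refine le_trans ?_ (le_ciSup (chainGap_bddAbove n q) t)
  refine le_ciInf fun i => ?_
  rw [sub_le_iff_le_add]
  refine (ciInf_le (chainGap_bddBelow n p t) i).trans ?_
  have h1 := ContinuousMap.dist_apply_le_dist (f := p) (g := q) (t i)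
  have h2 := ContinuousMap.dist_apply_le_dist (f := p) (g := q) (t (i + 1))
  have h3 := dist_triangle4 (p (t i)) (q (t i)) (q (t (i + 1))) (p (t (i + 1)))
  rw [dist_comm (q (t (i + 1)))] at h3
  simp only [NNReal.coe_ofNat]
  linarith

/-- A long chain on a path has a short step. -/
theorem exists_no_chain (q : C(I, M)) {e : ℝ} (he : 0 < e) :
    ∃ n : ℕ, ¬ ∃ t : ℕ →o I, ∀ i < n, e < dist (q (t i)) (q (t (i + 1))) := by
  obtain ⟨δ, hδ, h⟩ := Metric.uniformContinuous_iff.1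
    (CompactSpace.uniformContinuous_of_continuous q.continuous) e he
  obtain ⟨n, hn⟩ := exists_nat_gt (1 / δ)
  refine ⟨n, ?_⟩
  rintro ⟨t, ht⟩
  -- By uniform continuity every step longer than `e` takes time at least `δ`; as `n * δ > 1`, the
  -- chain would overrun the interval.
  have key : ∀ i ≤ n, i * δ ≤ (t i : ℝ) := by
    intro i
    induction i with
    | zero => intro _; simpa using (t 0).2.1
    | succ i ih =>
      intro hi
      have h1 := ih (by omega)
      have h2 : (t i : ℝ) ≤ t (i + 1) := t.monotone (Nat.le_succ i)
      have h3 : δ ≤ dist (t i) (t (i + 1)) := by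
        by_contra! h4
        exact (ht i (by omega)).not_gt (h h4)
      rw [dist_comm, Subtype.dist_eq, Real.dist_eq, abs_of_nonneg (by linarith)] at h3
      push_cast
      linarith
  have h1 := key n le_rfl
  rw [div_lt_iff₀ hδ] at hn
  linarith [(t n).2.2]

/-- A bounded variant of Morse's `μ`-length. -/
noncomputable def morseLength (q : C(I, M)) : ℝ :=
  ∑' n : ℕ, (1 / 2 : ℝ) ^ n * min 1 (chainGap n q)

theorem morseLength_term_le (n : ℕ) (q : C(I, M)) :
    ‖(1 / 2 : ℝ) ^ n * min 1 (chainGap n q)‖ ≤ (1 / 2 : ℝ) ^ n := by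
  have := chainGap_nonneg n q
  rw [Real.norm_of_nonneg (by positivity)]
  exact mul_le_of_le_one_right (by positivity) (min_le_left _ _)

theorem summable_morseLength (q : C(I, M)) :
    Summable fun n : ℕ => (1 / 2 : ℝ) ^ n * min 1 (chainGap n q) :=
  Summable.of_norm_bounded summable_geometric_two fun n => morseLength_term_le n q

theorem continuous_morseLength : Continuous (morseLength : C(I, M) → ℝ) :=
  continuous_tsum (fun n => continuous_const.mul (continuous_const.min (continuous_chainGap n)))
    summable_geometric_two morseLength_term_le

theorem morseLength_comp (q : C(I, M)) (γ : C(I, I)) (hγ : Monotone γ)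
    (hs : Function.Surjective γ) : morseLength (q.comp γ) = morseLength q := by
  simp only [morseLength, chainGap_comp _ q γ hγ hs]

theorem morseLength_comp_le (q : C(I, M)) (γ : C(I, I)) (hγ : Monotone γ) :
    morseLength (q.comp γ) ≤ morseLength q :=
  (summable_morseLength _).tsum_le_tsum (fun n => mul_le_mul_of_nonneg_left
    (min_le_min_left _ (chainGap_comp_le n q γ hγ)) (by positivity)) (summable_morseLength _)

theorem morseLength_const (x : M) : morseLength (ContinuousMap.const I x) = 0 := by
  simp [morseLength, chainGap]

/-! ### Truncated paths and the Morse clock -/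

/-- The map `t ↦ min t x`, depending on `x`. -/
def capAt : C(I, C(I, I)) := ContinuousMap.curry ⟨fun z : I × I => min z.2 z.1, by fun_prop⟩

@[simp] theorem capAt_apply (x t : I) : capAt x t = min t x := rfl

theorem capAt_monotone (x : I) : Monotone (capAt x) := fun _ _ h => min_le_min_right _ h

/-- The map `t ↦ max t x`, depending on `x`. -/
def floorAt : C(I, C(I, I)) := ContinuousMap.curry ⟨fun z : I × I => max z.2 z.1, by fun_prop⟩

@[simp] theorem floorAt_apply (x t : I) : floorAt x t = max t x := rfl

theorem floorAt_monotone (x : I) : Monotone (floorAt x) := fun _ _ h => max_le_max_right _ h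

/-- The Morse length of the part of the path `q` up to the time `x`. -/
noncomputable def morseClock (q : C(I, M)) (x : I) : ℝ := morseLength (q.comp (capAt x))

theorem morseClock_zero (q : C(I, M)) : morseClock q 0 = 0 := by
  rw [← morseLength_const (q 0), morseClock]
  congr 1
  ext t
  simp

theorem morseClock_mono (q : C(I, M)) : Monotone (morseClock q) := by
  intro x y hxy
  have : q.comp (capAt x) = (q.comp (capAt y)).comp (capAt x) := by
    ext t
    simp [min_assoc, min_eq_left hxy]
  rw [morseClock, this]
  exact morseLength_comp_le _ _ (capAt_monotone x)

/-- Truncating `q ∘ γ` at `x` gives the `γ`-reparametrization of `q` truncated at `γ x`. -/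
theorem morseClock_comp (q : C(I, M)) (γ : C(I, I)) (hγ : Monotone γ)
    (hs : Function.Surjective γ) (x : I) : morseClock (q.comp γ) x = morseClock q (γ x) := by
  rw [morseClock, morseClock, ← morseLength_comp (q.comp (capAt (γ x))) γ hγ hs]
  congr 1
  ext t
  simp [hγ.map_min]

theorem exists_morseClock_eq (q : C(I, M)) (v : I) :
    ∃ x : I, morseClock q x = v * morseClock q 1 := by
  have hc : Continuous (morseClock q) :=
    continuous_morseLength.comp (continuous_const.compCM capAt.continuous)
  have h1 : 0 ≤ morseClock q 1 := by
    rw [← morseClock_zero q]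
    exact morseClock_mono q unitInterval.le_one'
  refine intermediate_value_univ (0 : I) 1 hc ⟨?_, ?_⟩
  · rw [morseClock_zero]
    exact mul_nonneg v.2.1 h1
  · exact mul_le_of_le_one_left h1 v.2.2

/-- Every term of the series is monotone in the truncation time and has positive weight, so a strict
increase of one term would increase the sum. -/
theorem min_chainGap_le_of_morseClock_eq {q : C(I, M)} {x y : I} (hxy : x ≤ y)
    (h : morseClock q x = morseClock q y) (n : ℕ) :
    min 1 (chainGap n (q.comp (capAt y))) ≤ min 1 (chainGap n (q.comp (capAt x))) := by
  have hq : q.comp (capAt x) = (q.comp (capAt y)).comp (capAt x) := by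
    ext t
    simp [min_assoc, min_eq_left hxy]
  by_contra! hlt
  refine h.not_lt (Summable.tsum_lt_tsum (i := n) (fun m => ?_) ?_ (summable_morseLength _)
    (summable_morseLength _))
  · rw [hq]
    exact mul_le_mul_of_nonneg_left
      (min_le_min_left _ (chainGap_comp_le m _ _ (capAt_monotone x))) (by positivity)
  · exact mul_lt_mul_of_pos_left hlt (by positivity)

/-- The Morse clock stops only where the path stops. -/
theorem eq_of_morseClock_eq {q : C(I, M)} {x y : I} (hxy : x ≤ y)
    (h : morseClock q x = morseClock q y) : q x = q y := by
  by_contra hne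
  -- Below half the distance, no point is within `e` of both `q x` and `q y`; below 1, the cut-off
  -- in the series does not hide gaps of size `e`.
  obtain ⟨e, he0, he⟩ := exists_between (lt_min (half_pos (dist_pos.2 hne)) one_pos)
  obtain ⟨hed, he1⟩ := lt_min_iff.1 he
  classical
  have hex := exists_no_chain (q.comp (capAt x)) he0
  -- A longest chain with steps above `e` on the part up to `x` has `m` steps. It cannot be
  -- prolonged by `q x`, so it can be prolonged by `q y`, and the clock would have to increase.
  obtain ⟨m, hm⟩ : ∃ m, Nat.find hex = m + 1 := Nat.exists_eq_succ_of_ne_zero fun h0 =>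
    Nat.find_spec hex (by rw [h0]; exact ⟨⟨fun _ => 0, monotone_const⟩, by simp⟩)
  have hno := Nat.find_spec hex
  rw [hm] at hno
  obtain ⟨t, ht⟩ := not_not.1 (Nat.find_min hex (m := m) (by omega))
  have extend : ∀ z : I, x ≤ z → e < dist (q (min (t m) x)) (q z) →
      ∃ r : ℕ →o I, ∀ i < m + 1,
        e < dist (q.comp (capAt z) (r i)) (q.comp (capAt z) (r (i + 1))) := by
    intro z hz hez
    let f : ℕ → I := fun i => if i ≤ m then min (t i) x else z
    refine ⟨⟨f, ?_⟩, ?_⟩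
    · intro i j hij
      simp only [f]
      split_ifs with h1 h2
      · exact min_le_min_right _ (t.monotone hij)
      · exact (min_le_right _ _).trans hz
      · omega
      · exact le_rfl
    · intro i hi
      have h1 : i ≤ m := by omega
      have h2 : ∀ s : I, min (min s x) z = min s x := fun s =>
        min_eq_left ((min_le_right _ _).trans hz)
      change e < dist (q (min (f i) z)) (q (min (f (i + 1)) z))
      by_cases h3 : i + 1 ≤ m
      · simpa [f, h1, h3, h2] using ht i (by omega)
      · have h4 : i = m := by omega
        simpa [f, h4, h2] using hez
  have h1 : dist (q (min (t m) x)) (q x) ≤ e := by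
    by_contra! h2
    exact hno (extend x le_rfl h2)
  have h2 : e < dist (q (min (t m) x)) (q y) := by
    have := dist_triangle_left (q x) (q y) (q (min (t m) x))
    linarith
  have h3 : e < min 1 (chainGap m (q.comp (capAt y))) :=
    lt_min he1 (lt_chainGap_iff.2 (extend y hxy h2))
  exact hno (lt_chainGap_iff.1 ((h3.trans_le (min_chainGap_le_of_morseClock_eq hxy h m)).trans_le
    (min_le_right _ _)))

/-- The clock is monotone, hence constant between `x` and `y`, so the whole path rests there. -/
theorem comp_floorAt_eq_of_morseClock_eq {q : C(I, M)} {x y : I}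
    (h : morseClock q x = morseClock q y) : q.comp (floorAt x) = q.comp (floorAt y) := by
  wlog hxy : x ≤ y generalizing x y
  · exact (this h.symm (le_of_not_ge hxy)).symm
  ext t
  simp only [ContinuousMap.comp_apply, floorAt_apply]
  rcases le_total t y with hty | hty
  · rw [max_eq_right hty]
    have h1 : max t x ≤ y := max_le hty hxy
    refine eq_of_morseClock_eq h1 (le_antisymm (morseClock_mono q h1) ?_)
    rw [← h]
    exact morseClock_mono q (le_max_right _ _)
  · rw [max_eq_left hty, max_eq_left (hxy.trans hty)]

end MorseLength

/-- A continuous map on `P × I` that is constant where a clock stops can be reparametrized by the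
normalized clock. -/
theorem exists_continuousMap_of_clock {P T : Type*} [TopologicalSpace P] [TopologicalSpace T]
    {clock : P → I → ℝ} (hclock : Continuous fun z : P × I => clock z.1 z.2)
    (hex : ∀ (p : P) (v : I), ∃ t : I, clock p t = v * clock p 1) {ψ : P × I → T}
    (hψ : Continuous ψ) (hwell : ∀ p t t', clock p t = clock p t' → ψ (p, t) = ψ (p, t')) :
    ∃ H : C(P × I, T), ∀ (p : P) (v t : I), clock p t = v * clock p 1 → H (p, v) = ψ (p, t) := by
  choose τ hτ using hex
  -- The choice `τ` need not be continuous. `W` is closed and `I` is compact, so `W` projects onto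
  -- `P × I` by a quotient map, and `ψ` is constant on the fibres.
  let W : Set ((P × I) × I) := {z | clock z.1.1 z.2 = z.1.2 * clock z.1.1 1}
  have hW : IsClosed W := isClosed_eq
    (hclock.comp (f := fun z : (P × I) × I => (z.1.1, z.2)) (by fun_prop))
    ((continuous_subtype_val.comp (by fun_prop)).mul
      (hclock.comp (f := fun z : (P × I) × I => (z.1.1, 1)) (by fun_prop)))
  have hπ : Topology.IsQuotientMap fun w : W => w.1.1 :=
    (isClosedMap_fst_of_compactSpace.comp hW.isClosedMap_subtype_val).isQuotientMap
      (continuous_fst.comp continuous_subtype_val) fun z => ⟨⟨(z, τ z.1 z.2), hτ _ _⟩, rfl⟩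
  refine ⟨⟨fun z => ψ (z.1, τ z.1 z.2), ?_⟩, fun p v t h => hwell _ _ _ ((hτ p v).trans h.symm)⟩
  rw [hπ.continuous_iff]
  refine (hψ.comp (f := fun w : W => (w.1.1.1, w.1.2)) (by fun_prop)).congr fun w => ?_
  exact hwell _ _ _ (w.2.trans (hτ _ _).symm)

namespace DSpace

/-! ### Homotopies of trace spaces -/

section Traces

variable {X : Type u} [TopologicalSpace X] {D : DSpace X}

theorem Trace.continuous_mk {a b : X} :
    Continuous (Trace.mk : D.DPath a b → D.Trace a b) :=
  continuous_quot_mk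

theorem Reparam.mk_eq {a b : X} {p q : D.DPath a b} (h : Reparam p q) :
    Trace.mk p = Trace.mk q :=
  Quot.sound h

/-- A homotopy on path spaces that is invariant under reparametrization descends to trace
spaces. -/
theorem Trace.homotopic_of_invariant {a b a' b' : X} {f g : C(D.Trace a b, D.Trace a' b')}
    (H : C(D.DPath a b × I, D.Trace a' b'))
    (hH : ∀ p q, Reparam p q → ∀ v, H (p, v) = H (q, v))
    (h0 : ∀ p, H (p, 0) = f (Trace.mk p)) (h1 : ∀ p, H (p, 1) = g (Trace.mk p)) :
    f.Homotopic g := by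
  -- Currying avoids asking whether the product of a quotient map with `I` is again a quotient map.
  let K : C(D.Trace a b, C(I, D.Trace a' b')) :=
    ⟨Quot.lift H.curry fun p q h => ContinuousMap.ext (hH p q h),
      continuous_coinduced_dom.2 H.curry.continuous⟩
  refine ⟨⟨⟨fun z => K z.2 z.1, ?_⟩, ?_, ?_⟩⟩
  · exact (K.continuous.comp continuous_snd).eval continuous_fst
  · intro z
    induction z using Quot.ind with | mk p => exact h0 p
  · intro z
    induction z using Quot.ind with | mk p => exact h1 p

theorem DPath.continuous_iff {Z : Type*} [TopologicalSpace Z] {a b : X} {f : Z → D.DPath a b} :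
    Continuous f ↔ Continuous fun z : Z × I => (f z.1).1 z.2 := by
  rw [continuous_induced_rng, ← Path.continuous_uncurry_iff]
  rfl

theorem DPath.continuous_coe {a b : X} :
    Continuous fun p : D.DPath a b => (p.1 : C(I, X)) :=
  ContinuousMap.continuous_of_continuous_uncurry _ (DPath.continuous_iff.1 continuous_id)

/-- The part of a directed path after the time `t`. -/
def DPath.tail {a b : X} (p : D.DPath a b) (t : I) : D.DPath (p.1 t) b :=
  ⟨⟨(p.1 : C(I, X)).comp (floorAt t), by simp, by
    simp [unitInterval.le_one']⟩, D.comp_mem _ p.2 _ (floorAt_monotone t)⟩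

theorem DPath.tail_apply {a b : X} (p : D.DPath a b) (t s : I) :
    (p.tail t).1 s = p.1 (max s t) := rfl

theorem DPath.mem_Γ {a b : X} (p : D.DPath a b) : (a, b) ∈ D.Γ :=
  ⟨⟨p.1, p.2⟩, p.1.source, p.1.target⟩

/-- The part of a directed path before the time `t`. -/
def DPath.head {a b : X} (p : D.DPath a b) (t : I) : D.DPath a (p.1 t) :=
  ⟨⟨(p.1 : C(I, X)).comp (capAt t), by simp, by
    simp [unitInterval.le_one']⟩, D.comp_mem _ p.2 _ (capAt_monotone t)⟩

/-- The directed path from `a` to `b` given by a section of `χ`. -/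
def sectionPath (s : C(D.Γ, D.PathSpace)) (hs : ∀ z, D.χ (s z) = z) {a b : X}
    (h : (a, b) ∈ D.Γ) : D.DPath a b :=
  ⟨⟨(s ⟨(a, b), h⟩).1, congrArg (fun z : D.Γ => z.1.1) (hs ⟨(a, b), h⟩),
    congrArg (fun z : D.Γ => z.1.2) (hs ⟨(a, b), h⟩)⟩, (s ⟨(a, b), h⟩).2⟩

variable (s : C(D.Γ, D.PathSpace)) (hs : ∀ z, D.χ (s z) = z)

/-- The directed path `p` with its part before the time `t` replaced by the path chosen by a
section of `χ`. -/
noncomputable def replaceHead {a b : X} (p : D.DPath a b) (t : I) : D.DPath a b :=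
  (sectionPath s hs (p.head t).mem_Γ).trans (p.tail t)

theorem sectionPath_trans_congr {a b x y : X} (hxy : x = y) (hx : (a, x) ∈ D.Γ)
    (hy : (a, y) ∈ D.Γ) {p : D.DPath x b} {q : D.DPath y b}
    (hpq : (p.1 : C(I, X)) = (q.1 : C(I, X))) :
    (sectionPath s hs hx).trans p = (sectionPath s hs hy).trans q := by
  subst hxy
  rw [show p = q from Subtype.ext (Path.ext (funext fun r => DFunLike.congr_fun hpq r))]

/-- Between the two times the path rests, so both the cutting point and the tail agree. -/
theorem replaceHead_eq_of_morseClock_eq {M : Type*} [MetricSpace M] (e : C(X, M))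
    (he : Function.Injective e) {a b : X} {p : D.DPath a b} {t t' : I}
    (h : morseClock (e.comp (p.1 : C(I, X))) t = morseClock (e.comp (p.1 : C(I, X))) t') :
    replaceHead s hs p t = replaceHead s hs p t' := by
  have h1 : (p.1 : C(I, X)).comp (floorAt t) = (p.1 : C(I, X)).comp (floorAt t') :=
    ContinuousMap.ext fun r => he (DFunLike.congr_fun (comp_floorAt_eq_of_morseClock_eq h) r)
  exact sectionPath_trans_congr s hs (by simpa using DFunLike.congr_fun h1 0) _ _ h1

theorem continuous_replaceHead {a b : X} :
    Continuous fun z : D.DPath a b × I => replaceHead s hs z.1 z.2 := by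
  have hev : Continuous fun z : (D.DPath a b × I) × I => z.1.1.1 z.2 :=
    DPath.continuous_iff.1 continuous_fst
  have hev' : Continuous fun z : D.DPath a b × I => z.1.1 z.2 :=
    DPath.continuous_iff.1 continuous_id
  rw [DPath.continuous_iff]
  refine Path.trans_continuous_family
    (fun z : D.DPath a b × I => (sectionPath s hs (z.1.head z.2).mem_Γ).1) ?_
    (fun z : D.DPath a b × I => (z.1.tail z.2).1) ?_
  · have h1 : Continuous fun z : D.DPath a b × I =>
        (s ⟨(a, z.1.1 z.2), (z.1.head z.2).mem_Γ⟩).1 :=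
      continuous_subtype_val.comp (s.continuous.comp (by fun_prop))
    exact (h1.comp continuous_fst).eval continuous_snd
  · exact hev'.comp (f := fun z : (D.DPath a b × I) × I => (z.1.1, max z.2 z.1.2)) (by fun_prop)

/-- The cutting points coincide, so the new heads do too; the same `γ` relates the tails because it
commutes with `max`. -/
theorem replaceHead_comp {a b : X} {p q : D.DPath a b} {γ : C(I, I)} (hm : Monotone γ)
    (hs' : Function.Surjective γ) (hγ : ∀ t, p.1 (γ t) = q.1 t) (t : I) :
    Trace.mk (replaceHead s hs p (γ t)) = Trace.mk (replaceHead s hs q t) := by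
  have key : ∀ (x y : X) (hxy : x = y) (hx : (a, x) ∈ D.Γ) (hy : (a, y) ∈ D.Γ)
      (p' : D.DPath x b) (q' : D.DPath y b), (∀ r, p'.1 (γ r) = q'.1 r) →
      Trace.mk ((sectionPath s hs hx).trans p') = Trace.mk ((sectionPath s hs hy).trans q') := by
    rintro x _ rfl hx hy p' q' hpq
    exact (Reparam.trans_right _ ⟨γ, hm, hs', hpq⟩).mk_eq
  refine key _ _ (hγ t) _ _ _ _ fun r => ?_
  rw [DPath.tail_apply, DPath.tail_apply, ← hm.map_max, hγ]

/-- If `χ` has a continuous section and the underlying space injects continuously into a metric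
space, then composing traces with the loop `s (a, a)` is homotopic to a constant map. -/
theorem Trace.homotopic_const {M : Type*} [MetricSpace M] (e : C(X, M))
    (he : Function.Injective e) {a b : X} (hab : (a, b) ∈ D.Γ) (haa : (a, a) ∈ D.Γ) :
    ∃ c : D.Trace a b,
      (Trace.extend (Trace.mk (sectionPath s hs haa)) (Trace.refl D b)).Homotopic
        (ContinuousMap.const (D.Trace a b) c) := by
  have hclock : Continuous fun z : D.DPath a b × I =>
      morseClock (e.comp (z.1.1 : C(I, X))) z.2 := by
    have h1 : Continuous fun z : D.DPath a b × I => (z.1.1 : C(I, X)) :=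
      DPath.continuous_coe.comp continuous_fst
    have h2 : Continuous fun z : D.DPath a b × I => e.comp (z.1.1 : C(I, X)) :=
      e.continuous_postcomp.comp h1
    exact continuous_morseLength.comp (h2.compCM (capAt.continuous.comp continuous_snd))
  -- Stage `v` of the homotopy replaces the head up to any time at which the clock reads the
  -- fraction `v` of its total.
  obtain ⟨H, hH⟩ := exists_continuousMap_of_clock hclock
    (fun p v => exists_morseClock_eq (e.comp (p.1 : C(I, X))) v)
    (Trace.continuous_mk.comp (continuous_replaceHead s hs (a := a) (b := b)))
    (fun p t t' h => congrArg Trace.mk (replaceHead_eq_of_morseClock_eq s hs e he h))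
  refine ⟨Trace.mk ((sectionPath s hs hab).trans (DPath.refl D b)),
    Trace.homotopic_of_invariant H ?_ (fun p => ?_) (fun p => ?_)⟩
  · rintro p q ⟨γ, hm, hs', hγ⟩ v
    have hcl : ∀ t, morseClock (e.comp (q.1 : C(I, X))) t =
        morseClock (e.comp (p.1 : C(I, X))) (γ t) := by
      intro t
      rw [← morseClock_comp _ γ hm hs' t]
      congr 1
      ext r
      exact congrArg e (hγ r).symm
    obtain ⟨t, ht⟩ := exists_morseClock_eq (e.comp (q.1 : C(I, X))) v
    rw [hH q v t ht]
    rw [hcl, hcl, (endpoints_of_surjective γ hm hs').2] at ht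
    rw [hH p v (γ t) ht]
    exact replaceHead_comp s hs hm hs' hγ t
  -- At stage 0 the cut is at time 0: `s (a, a)` is followed by all of `p`.
  · rw [hH p 0 0 (by simp [morseClock_zero])]
    change _ = ((Trace.mk (sectionPath s hs haa)).trans (Trace.mk p)).trans (Trace.refl D b)
    rw [Trace.trans_refl]
    exact congrArg Trace.mk (sectionPath_trans_congr s hs p.1.source _ haa (by ext r; simp [DPath.tail]))
  -- At stage 1 only a constant tail of `p` remains.
  · rw [hH p 1 1 (by simp)]
    refine congrArg Trace.mk (sectionPath_trans_congr s hs p.1.target _ hab ?_)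
    ext r
    simp [DPath.tail, DPath.refl, unitInterval.le_one']

/-- The trace spaces of a d-space with a continuous section `s` of `χ` such that the loops
`s (a, a)` are contractible through directed loops are contractible. -/
theorem Trace.contractibleSpace {M : Type*} [MetricSpace M] (e : C(X, M))
    (he : Function.Injective e) {a b : X} (hab : (a, b) ∈ D.Γ) (haa : (a, a) ∈ D.Γ)
    (hjoin : Joined (sectionPath s hs haa) (DPath.refl D a)) :
    ContractibleSpace (D.Trace a b) := by
  rw [contractible_iff_id_nullhomotopic]
  obtain ⟨c, hc⟩ := Trace.homotopic_const s hs e he hab haa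
  refine ⟨c, ContinuousMap.Homotopic.trans ?_ hc⟩
  obtain ⟨ω⟩ := hjoin.symm
  have hcont : Continuous fun z : D.DPath a b × I => (ω z.2).trans z.1 := by
    unfold DPath.trans
    refine Continuous.subtype_mk ?_ _
    fun_prop
  refine Trace.homotopic_of_invariant ⟨_, Trace.continuous_mk.comp hcont⟩
    (fun p q h v => (Reparam.trans_right (ω v) h).mk_eq) (fun p => ?_) (fun p => ?_)
  · change Trace.mk ((ω 0).trans p) = Trace.mk p
    rw [ω.source]
    exact Trace.refl_trans (Trace.mk p)
  · change Trace.mk ((ω 1).trans p) =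
      ((Trace.mk (sectionPath s hs haa)).trans (Trace.mk p)).trans (Trace.refl D b)
    rw [ω.target, Trace.trans_refl]
    rfl

end Traces

end DSpace

/-! ### Singular homology of contractible spaces -/

section SingularHomology

open Limits AlgebraicTopology

variable {C : Type v} [Category.{w} C] [Preadditive C] [HasCoproducts.{u} C]
  [CategoryWithHomology C]

theorem singularHomology_map_congr (n : ℕ) (R : C) {Y Z : TopCat.{u}} {f g : Y ⟶ Z}
    (h : f.hom.Homotopic g.hom) :
    ((singularHomologyFunctor C n).obj R).map f = ((singularHomologyFunctor C n).obj R).map g :=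
  TopCat.Homotopy.congr_homologyMap_singularChainComplexFunctor h.some R n

theorem ContractibleSpace.homotopic {Y Z : Type*} [TopologicalSpace Y] [TopologicalSpace Z]
    [ContractibleSpace Z] (f g : C(Y, Z)) : f.Homotopic g := by
  obtain ⟨z, hz⟩ := id_nullhomotopic Z
  exact (hz.comp (.refl f)).trans (hz.comp (.refl g)).symm

/-- Maps into a contractible space are all homotopic, so any map backwards, for instance a constant
one, is a homotopy inverse. -/
theorem isIso_singularHomology_map (n : ℕ) (R : C) {Y Z : TopCat.{u}} [ContractibleSpace Y]
    [ContractibleSpace Z] (f : Y ⟶ Z) : IsIso (((singularHomologyFunctor C n).obj R).map f) := by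
  obtain ⟨y⟩ := ContractibleSpace.instPathConnectedSpace.nonempty (X := Y)
  let g : Z ⟶ Y := TopCat.ofHom (ContinuousMap.const Z y)
  refine ⟨((singularHomologyFunctor C n).obj R).map g, ?_, ?_⟩ <;>
  · rw [← Functor.map_comp, ← CategoryTheory.Functor.map_id]
    exact singularHomology_map_congr n R (ContractibleSpace.homotopic _ _)

theorem isZero_singularHomology_of_contractible {n : ℕ} (hn : n ≠ 0) (R : C) (Y : TopCat.{u})
    [ContractibleSpace Y] : IsZero (((singularHomologyFunctor C n).obj R).obj Y) := by
  let f : Y ⟶ TopCat.of PUnit.{u + 1} := TopCat.ofHom (ContinuousMap.const Y PUnit.unit)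
  have := isIso_singularHomology_map n R f
  exact (isZero_singularHomologyFunctor_of_totallyDisconnectedSpace C n R _ hn).of_iso
    (asIso (((singularHomologyFunctor C n).obj R).map f))

/-- The zeroth singular homology of a contractible space. -/
noncomputable def singularHomologyZeroIso (R : C) (Y : TopCat.{u}) [ContractibleSpace Y] :
    ((singularHomologyFunctor C 0).obj R).obj Y ≅ R :=
  asIso (Y.singularHomology₀ε R)

end SingularHomology

/-- A functor that inverts all morphisms, on a nonempty category, and whose values are all
isomorphic to `A` is bisimulation equivalent to `A` on the terminal category. -/
theorem bisimulationEquivalent_oneFunctor {F : Type*} [Category* F] [Nonempty F]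
    (P : F ⥤ AddCommGrpCat.{w}) (A : AddCommGrpCat.{w}) (hA : ∀ x, Nonempty (P.obj x ≅ A))
    (hP : ∀ {x x' : F} (f : x ⟶ x'), IsIso (P.map f)) :
    BisimulationEquivalent P (oneFunctor A) := by
  refine ⟨fun _ _ => Set.univ, ⟨fun x => ?_, fun y => ?_, ?_, ?_⟩⟩
  · exact ⟨⟨PUnit.unit⟩, (hA x).some, trivial⟩
  · exact ⟨Classical.arbitrary F, (hA _).some, trivial⟩
  · intro x x' f y η _
    have := hP f
    exact ⟨y, 𝟙 y, (asIso (P.map f)).symm ≪≫ η, trivial, by simp⟩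
  · intro y y' g x η _
    obtain rfl : y = y' := Subsingleton.elim _ _
    obtain rfl : g = 𝟙 y := Subsingleton.elim _ _
    exact ⟨x, 𝟙 x, η, trivial, by simp⟩

/-! ### Natural homology of d-spaces with contractible trace spaces -/

namespace DSpace

variable {X : Type u} [TopologicalSpace X] {D : DSpace X}

theorem bisimulationEquivalent_of_contractible [Nonempty X]
    (h : ∀ a b, (a, b) ∈ D.Γ → ContractibleSpace (D.Trace a b)) :
    BisimulationEquivalent (D.naturalHomology 1) (oneFunctor (AddCommGrpCat.of (ULift.{u} ℤ))) ∧
    ∀ n : ℕ, 1 < n →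
      BisimulationEquivalent (D.naturalHomology n)
        (oneFunctor (AddCommGrpCat.of PUnit.{u + 1})) := by
  have hne : Nonempty D.TraceCat := ⟨⟨_, _, Trace.refl D (Classical.arbitrary X)⟩⟩
  have hc : ∀ p : D.TraceCat, ContractibleSpace (TopCat.of (D.Trace p.src p.tgt)) := by
    rintro ⟨a, b, t⟩
    induction t using Quot.ind with | mk t => exact h a b t.mem_Γ
  have hiso : ∀ (n : ℕ) {p q : D.TraceCat} (f : p ⟶ q), IsIso ((D.naturalHomology n).map f) :=
    fun n p q f =>
      have := hc p
      have := hc q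
      isIso_singularHomology_map (Y := TopCat.of (D.Trace p.src p.tgt))
        (Z := TopCat.of (D.Trace q.src q.tgt)) _ _ _
  refine ⟨bisimulationEquivalent_oneFunctor _ _ (fun p => ?_) (hiso 1),
    fun n hn => bisimulationEquivalent_oneFunctor _ _ (fun p => ?_) (hiso n)⟩
  · have := hc p
    exact ⟨singularHomologyZeroIso _ (TopCat.of (D.Trace p.src p.tgt))⟩
  · have := hc p
    exact ⟨(isZero_singularHomology_of_contractible (by omega) _
      (TopCat.of (D.Trace p.src p.tgt))).iso (AddCommGrpCat.isZero_of_subsingleton _)⟩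

/-! ### Continuous sections of `χ` -/

theorem refl_mem_Γ (D : DSpace X) (a : X) : (a, a) ∈ D.Γ := (DPath.refl D a).mem_Γ

theorem exists_section_of_diTC_eq_one (h : D.diTC = 1) :
    ∃ s : C(D.Γ, D.PathSpace), ∀ z, D.χ (s z) = z := by
  have h1 : D.HasPatchwork 1 := by
    -- An infimum below 2 yields a patchwork with fewer than 2 pieces; it has at least 1, since the
    -- infimum is 1.
    obtain ⟨n, hn⟩ : ∃ n : ℕ, (⨅ _ : D.HasPatchwork n, (n : ℕ∞)) < 2 := by
      rw [← iInf_lt_iff]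
      exact h.trans_lt (by norm_num)
    obtain ⟨hp, hn⟩ := iInf_lt_iff.1 hn
    have h2 : D.diTC ≤ n := iInf₂_le n hp
    rw [h] at h2
    have h3 : n < 2 := by exact_mod_cast hn
    have h4 : 1 ≤ n := by exact_mod_cast h2
    obtain rfl : n = 1 := by omega
    exact hp
  obtain ⟨s, F, hs, hF, -, hc⟩ := h1
  refine ⟨⟨s, ?_⟩, hs⟩
  have : F 0 = Set.univ := (iSup_unique (f := F)).symm.trans hF
  rw [← continuousOn_univ, ← this]
  exact (hc 0).2

/-- On an empty space zero pieces suffice. A point of `X` is needed for the bisimulation to reach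
the object of the terminal category. -/
theorem nonempty_of_diTC_ne_zero (h : D.diTC ≠ 0) : Nonempty X := by
  by_contra hX
  rw [not_nonempty_iff] at hX
  refine h (le_antisymm (iInf₂_le_of_le 0 ?_ le_rfl) bot_le)
  have : IsEmpty D.Γ := ⟨fun z => isEmptyElim z.1.1⟩
  exact ⟨isEmptyElim, isEmptyElim, isEmptyElim, Set.eq_univ_of_forall isEmptyElim,
    fun i => i.elim0, fun i => i.elim0⟩

/-- A monotone loop is squeezed between its equal endpoints, by antisymmetry. -/
theorem IsPospace.eq_refl (h : D.IsPospace) {a : X} (p : D.DPath a a) : p = DPath.refl D a := by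
  obtain ⟨_, -, hD⟩ := h
  have hp : Monotone (p.1 : C(I, X)) := hD.subset p.2
  refine Subtype.ext (Path.ext (funext fun t => le_antisymm ?_ ?_))
  · exact (hp unitInterval.le_one').trans_eq p.1.target
  · exact p.1.source.symm.trans_le (hp unitInterval.nonneg')

instance : Subsingleton (point.DPath () ()) := 
  ⟨fun _ _ => Subtype.ext (Path.ext (funext fun _ => rfl))⟩

/-- Evaluating the graded map on the only path of the point gives the section. On `PX(a, a)` the
composite with `Pf` is constant at the loop `s (a, a)`, so its homotopy to the identity, followed at
the constant loop, is the required path of loops. -/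
theorem IsDicontractible.exists_section (h : D.IsDicontractible) :
    ∃ (s : C(D.Γ, D.PathSpace)) (hs : ∀ z, D.χ (s z) = z),
      ∀ a, Joined (sectionPath s hs (D.refl_mem_Γ a)) (DPath.refl D a) := by
  obtain ⟨f, hf, -, -, -, ⟨F, hF⟩, -⟩ := h
  let c : point.DPath () () := DPath.refl point ()
  let s : C(D.Γ, D.PathSpace) :=
    ⟨fun z => F.toFun () () (c, ⟨z.1, z.2, rfl, rfl⟩),
      (F.toFun () ()).continuous.comp (by fun_prop)⟩
  have hs : ∀ z, D.χ (s z) = z := fun z =>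
    Subtype.ext (Prod.ext (F.source () () c _) (F.target () () c _))
  refine ⟨s, hs, fun a => ?_⟩
  obtain ⟨H⟩ := (hF a a (D.refl_mem_Γ a)).1
  have h0 := H.map_zero_left (DPath.refl D a)
  refine ⟨⟨⟨fun t => H (t, DPath.refl D a), by fun_prop⟩, h0.trans ?_, H.map_one_left _⟩⟩
  have : mapDPath f hf a a (DPath.refl D a) = c := Subsingleton.elim (α := point.DPath () ()) _ _
  change F.component a a (D.refl_mem_Γ a) (mapDPath f hf a a (DPath.refl D a)) = _
  rw [this]
  rfl

theorem IsDicontractible.nonempty (h : D.IsDicontractible) : Nonempty X := by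
  obtain ⟨-, -, g, -⟩ := h
  exact ⟨g ()⟩

end DSpace

/-- Supplies the distance in which Morse lengths are measured. -/
theorem IsENR.exists_injective {X : Type*} [TopologicalSpace X] (h : IsENR X) :
    ∃ (n : ℕ) (e : C(X, EuclideanSpace ℝ (Fin n))), Function.Injective e := by
  obtain ⟨n, e, -, -, -, he, -⟩ := h
  exact ⟨n, ⟨e, he.continuous⟩, he.injective⟩

theorem mainTheorem8 {X : Type u} [TopologicalSpace X] (D : DSpace X) (hX : IsENR X)
    (h : (D.IsPospace ∧ D.diTC = 1) ∨ D.IsDicontractible) :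
    BisimulationEquivalent (D.naturalHomology 1) (oneFunctor (AddCommGrpCat.of (ULift.{u} ℤ))) ∧
    ∀ n : ℕ, 1 < n →
      BisimulationEquivalent (D.naturalHomology n)
        (oneFunctor (AddCommGrpCat.of PUnit.{u + 1})) := by
  obtain ⟨k, e, he⟩ := hX.exists_injective
  have hne : Nonempty X := h.elim
    (fun h => DSpace.nonempty_of_diTC_ne_zero (by rw [h.2]; exact one_ne_zero)) (·.nonempty)
  obtain ⟨s, hs, hj⟩ : ∃ (s : C(D.Γ, D.PathSpace)) (hs : ∀ z, D.χ (s z) = z),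
      ∀ a, Joined (DSpace.sectionPath s hs (D.refl_mem_Γ a)) (DSpace.DPath.refl D a) := by
    rcases h with ⟨hpo, hTC⟩ | hdi
    · obtain ⟨s, hs⟩ := DSpace.exists_section_of_diTC_eq_one hTC
      exact ⟨s, hs, fun a => by rw [hpo.eq_refl (DSpace.sectionPath s hs _)]⟩
    · exact hdi.exists_section
  exact DSpace.bisimulationEquivalent_of_contractible fun a b hab =>
    DSpace.Trace.contractibleSpace s hs e he hab (D.refl_mem_Γ a) (hj a)
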